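/- Theorem. Throughout, $\log$ is the logarithm to base $2$. In the problem $\mathbf{UR}^{\subset}$ on $n$-bit vectors, Alice receives $x\in\{0,1\}^n$ and Bob receives $y\in\{0,1\}^n$ together with the number $\|x\|_0$ of ones of $x$, with the promise that $\mathrm{support}(y)\subsetneq \mathrm{support}(x)$; Bob must output an index $i$ with $x_i\neq y_i$. In a one-way public-coin protocol, Alice and Bob share a random string, Alice sends a single binary message depending on the shared randomness and $x$, and Bob's output depends on the shared randomness, this message, and his own input. The protocol has failure probability $\delta$ if, for every fixed pair of inputs satisfying the promise, Bob's output is incorrect with probability at most $\delta$ over the shared randomness. Its cost is the maximum length in bits of Alice's message, and $\mathbf{R}^{\rightarrow,pub}_\delta(\mathbf{UR}^{\subset})$ denotes the minimum cost of such a protocol with failure probability $\delta$. There is an absolute constant $c>0$ such that for every natural number $n$ and every real $\delta>0$ with $64\le \log\frac1\delta\le \frac n{64}$, $$\mathbf{R}^{\rightarrow,pub}_\delta(\mathbf{UR}^{\subset})\ \ge\ c\,\log\tfrac1\delta\,\log^2\!\Big(\frac{n}{\log(1/\delta)}\Big).$$ -/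

import Mathlib

open MeasureTheory
open scoped ENNReal

/-- A two-party promise search problem. Alice holds `x : X`, Bob holds `y : Y`; only the input
pairs satisfying `promise` can occur, and on those an output `z : Z` is correct if `valid x y z`. -/
structure CommProblem (X Y Z : Type) where
  promise : X → Y → Prop
  valid : X → Y → Z → Prop

/-- A one-way public-coin protocol. A sample `r` from the probability space `(Coins, μ)` is seen by
both players. Alice sends the single binary message `alice r x`; Bob, who sees `r`, this message and
his own input `y`, produces the output. -/
structure OneWayProtocol (X Y Z : Type) where
  Coins : Type
  [mCoins : MeasurableSpace Coins]
  μ : Measure Coins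
  [isProb : IsProbabilityMeasure μ]
  alice : Coins → X → List Bool
  bob : Coins → List Bool → Y → Z
  measurable_alice : ∀ x : X, Measurable[mCoins, ⊤] (fun r => alice r x)
  measurable_bob : ∀ (msg : List Bool) (y : Y), Measurable[mCoins, ⊤] (fun r => bob r msg y)

namespace OneWayProtocol

variable {X Y Z : Type}

/-- The output of the protocol on the input pair `(x, y)` with public coins `r`. -/
def output (P : OneWayProtocol X Y Z) (r : P.Coins) (x : X) (y : Y) : Z :=
  P.bob r (P.alice r x) y

/-- The communication cost: the largest length in bits of Alice's message, over all her inputs and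
all outcomes of the public coins. -/
noncomputable def cost (P : OneWayProtocol X Y Z) : ℕ∞ :=
  ⨆ (r : P.Coins) (x : X), ((P.alice r x).length : ℕ∞)

/-- `P` solves `f` with failure probability (at most) `δ`: on every fixed pair of inputs allowed by
the promise, the output is incorrect with probability at most `δ` over the public coins. -/
def Solves (P : OneWayProtocol X Y Z) (f : CommProblem X Y Z) (δ : ℝ) : Prop :=
  ∀ x y, f.promise x y →
    P.μ {r | ¬ f.valid x y (P.output r x y)} ≤ ENNReal.ofReal δ

end OneWayProtocol

/-- The randomized one-way public-coin communication complexity of `f` with failure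
probability `δ`: the least cost of a protocol solving `f` with failure probability `δ`. -/
noncomputable def oneWayPubCC {X Y Z : Type} (δ : ℝ) (f : CommProblem X Y Z) : ℕ∞ :=
  ⨅ (P : OneWayProtocol X Y Z) (_ : P.Solves f δ), P.cost

/-- The support of a vector in `{0,1}ⁿ`. -/
def bitSupport {n : ℕ} (x : Fin n → Bool) : Finset (Fin n) :=
  Finset.univ.filter (fun i => x i = true)

/-- The universal relation problem with the subset promise. Alice holds `x ∈ {0,1}ⁿ`; Bob holds
`y ∈ {0,1}ⁿ` and also knows the number `‖x‖₀` of ones of `x`. The promise is that the support of `y`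
is a proper subset of the support of `x`. An output `i` is correct if `x i ≠ y i`. -/
def URsub (n : ℕ) : CommProblem (Fin n → Bool) ((Fin n → Bool) × ℕ) (Fin n) where
  promise x b := bitSupport b.1 ⊂ bitSupport x ∧ b.2 = (bitSupport x).card
  valid x b i := x i ≠ b.1 i

/-!
Alice's single message about a set `S` can be queried many times. Bob starts with the empty set and
lets it grow inside `S`; writing `Q` for what is left of `S`, each query `S \ Q` should make him
name an element of `Q`. After each query the named element leaves `Q`, and so does every element
outside a publicly known random set `ω` of density `p`.

The queries depend on earlier answers, hence on the coins, so the error bound does not apply to them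
directly. But if nothing were named, the current set before round `r` would be a random subset of
`S` of density `p ^ r`, independent of the coins; and since only one element per round is removed
adaptively, the true distribution of the current set is pointwise at most
`∏ j < r, (1 - p ^ (j + 1))⁻¹ ≤ exp (2 * p / (1 - p))` times that one (`expectedMisses_le`,
`prod_inv_one_sub_pow_le`). With `p / (1 - p)` a small multiple of `L = log (1 / δ)` this factor is
absorbed by the failure probability, and Bob misses in few of the roughly `L * log (n / L)` rounds
that are possible before `Q` becomes too small.

Hence `S` can be recovered from the message, one bit per round telling whether the answer was
correct, and the elements that were never named (`found_injective`). If `S` is random with odds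
`ρ = √(L / n)` per element, leaving out `k` elements gains a factor `ρ ^ k` in weight, so comparing
total weights gives `1 / 2 ≤ 2 ^ (s + 1) * 2 ^ R * ρ ^ k` for messages of at most `s` bits and
`k ≥ 3 * R / 4` (`sum_weight_le_of_many_found`, `half_le_of_solves`). Taking logarithms,
`s` is at least of the order of `R * log (n / L)`, that is `L * log (n / L) ^ 2`.
-/

/-! ### Random thinning of a finite set -/

section Thinning

variable {V : Type*} [DecidableEq V]

/-- The expectation of `h T`, where `T` is the random subset of `Q` that keeps each element of `Q`
independently with probability `q`. -/
noncomputable def thin (q : ℝ) (h : Finset V → ℝ) (Q : Finset V) : ℝ :=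
  ∑ T ∈ Q.powerset, q ^ T.card * (1 - q) ^ (Q \ T).card * h T

theorem thin_empty (q : ℝ) (h : Finset V → ℝ) : thin q h ∅ = h ∅ := by
  simp [thin]

theorem thin_insert (q : ℝ) (h : Finset V → ℝ) {a : V} {Q : Finset V} (ha : a ∉ Q) :
    thin q h (insert a Q) =
      q * thin q (fun T => h (insert a T)) Q + (1 - q) * thin q h Q := by
  unfold thin
  rw [Finset.sum_powerset_insert ha, add_comm, Finset.mul_sum, Finset.mul_sum]
  congr 1
  · refine Finset.sum_congr rfl fun T hT => ?_
    have haT : a ∉ T := fun h' => ha (Finset.mem_powerset.1 hT h')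
    have : insert a Q \ insert a T = Q \ T := by
      ext x; simp only [Finset.mem_sdiff, Finset.mem_insert]; grind
    rw [this, Finset.card_insert_of_notMem haT]
    ring
  · refine Finset.sum_congr rfl fun T hT => ?_
    have haT : a ∉ T := fun h' => ha (Finset.mem_powerset.1 hT h')
    rw [Finset.insert_sdiff_of_notMem _ haT,
      Finset.card_insert_of_notMem (fun h' => ha (Finset.mem_sdiff.1 h').1)]
    ring

theorem thin_mono {q : ℝ} (h0 : 0 ≤ q) (h1 : q ≤ 1) {h h' : Finset V → ℝ} {Q : Finset V}
    (hh : ∀ T ⊆ Q, h T ≤ h' T) : thin q h Q ≤ thin q h' Q := by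
  have := sub_nonneg.2 h1
  exact Finset.sum_le_sum fun T hT =>
    mul_le_mul_of_nonneg_left (hh T (Finset.mem_powerset.1 hT)) (by positivity)

theorem thin_congr {q : ℝ} {h h' : Finset V → ℝ} {Q : Finset V}
    (hh : ∀ T ⊆ Q, h T = h' T) : thin q h Q = thin q h' Q :=
  Finset.sum_congr rfl fun T hT => by rw [hh T (Finset.mem_powerset.1 hT)]

theorem thin_add (q : ℝ) (h h' : Finset V → ℝ) (Q : Finset V) :
    thin q (fun T => h T + h' T) Q = thin q h Q + thin q h' Q := by
  simp only [thin, mul_add, Finset.sum_add_distrib]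

theorem thin_const_mul (q c : ℝ) (h : Finset V → ℝ) (Q : Finset V) :
    thin q (fun T => c * h T) Q = c * thin q h Q := by
  simp only [thin, Finset.mul_sum]
  exact Finset.sum_congr rfl fun T _ => by ring

theorem thin_sum {ι : Type*} (q : ℝ) (s : Finset ι) (h : ι → Finset V → ℝ) (Q : Finset V) :
    thin q (fun T => ∑ i ∈ s, h i T) Q = ∑ i ∈ s, thin q (h i) Q := by
  simp only [thin, Finset.mul_sum]
  exact Finset.sum_comm

theorem thin_const (q c : ℝ) (Q : Finset V) : thin q (fun _ => c) Q = c := by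
  induction Q using Finset.induction_on with
  | empty => simp [thin_empty]
  | insert a Q ha ih => rw [thin_insert _ _ ha, ih]; ring

theorem thin_nonneg {q : ℝ} (h0 : 0 ≤ q) (h1 : q ≤ 1) {h : Finset V → ℝ} (hh : ∀ T, 0 ≤ h T)
    (Q : Finset V) : 0 ≤ thin q h Q := by
  rw [← thin_const q 0 Q]
  exact thin_mono h0 h1 fun T _ => hh T

theorem thin_one (h : Finset V → ℝ) (Q : Finset V) : thin 1 h Q = h Q := by
  induction Q using Finset.induction_on generalizing h with
  | empty => simp [thin_empty]
  | insert a Q ha ih => rw [thin_insert _ _ ha, ih]; ring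

/-- Thinning twice is thinning once by the product of the rates. -/
theorem thin_thin (p q : ℝ) (h : Finset V → ℝ) (Q : Finset V) :
    thin p (thin q h) Q = thin (p * q) h Q := by
  induction Q using Finset.induction_on generalizing h with
  | empty => simp [thin_empty]
  | insert a Q ha ih =>
    have key : thin p (fun T => thin q h (insert a T)) Q =
        q * thin p (thin q fun T => h (insert a T)) Q + (1 - q) * thin p (thin q h) Q := by
      rw [← thin_const_mul, ← thin_const_mul, ← thin_add]
      exact thin_congr fun T hT => thin_insert _ _ fun h' => ha (hT h')
    rw [thin_insert _ _ ha, thin_insert _ _ ha, key, ih, ih]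
    ring

/-- A random subset of `U`, intersected with `Q`, is a random subset of `Q ∩ U`. -/
theorem thin_inter (p : ℝ) (h : Finset V → ℝ) (Q U : Finset V) :
    thin p (fun ω => h (Q ∩ ω)) U = thin p h (Q ∩ U) := by
  induction U using Finset.induction_on generalizing h with
  | empty => simp [thin_empty]
  | insert a U ha ih =>
    rw [thin_insert _ _ ha, ih]
    by_cases haQ : a ∈ Q
    · simp only [Finset.inter_insert_of_mem haQ]
      rw [ih fun T => h (insert a T),
        thin_insert _ _ fun h' => ha (Finset.mem_inter.1 h').2]
    · simp only [Finset.inter_insert_of_notMem haQ]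
      rw [ih]; ring

theorem thin_ite_empty (q : ℝ) (Q : Finset V) :
    thin q (fun T => if T = ∅ then 1 else 0) Q = (1 - q) ^ Q.card := by
  unfold thin
  rw [Finset.sum_eq_single ∅]
  · simp
  · intro T _ hT; simp [hT]
  · intro h'; simp at h'

/-- Fixing one element to be absent costs a factor of at most the inverse of the probability that
it is absent anyway. -/
theorem thin_erase_le {q : ℝ} (h0 : 0 ≤ q) (h1 : q < 1) {h : Finset V → ℝ} (hh : ∀ T, 0 ≤ h T)
    (Q : Finset V) (s : V) : thin q h (Q.erase s) ≤ (1 - q)⁻¹ * thin q h Q := by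
  have h2 : 0 < 1 - q := sub_pos.2 h1
  rw [inv_mul_eq_div, le_div_iff₀ h2, mul_comm]
  by_cases hs : s ∈ Q
  · conv_rhs => rw [← Finset.insert_erase hs, thin_insert _ _ (Finset.notMem_erase s Q)]
    have := thin_nonneg h0 h1.le (fun T => hh (insert s T)) (Q.erase s)
    nlinarith
  · rw [Finset.erase_eq_of_notMem hs]
    have := thin_nonneg h0 h1.le hh Q
    nlinarith

theorem exists_le_of_thin_le [Finite V] {q c : ℝ} (h0 : 0 ≤ q) (h1 : q ≤ 1) {F : Finset V → ℝ}
    {Q : Finset V} (hF : thin q F Q ≤ c) : ∃ ω, F ω ≤ c := by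
  obtain ⟨ω, hω⟩ := Finite.exists_min F
  refine ⟨ω, le_trans ?_ hF⟩
  rw [← thin_const q (F ω) Q]
  exact thin_mono h0 h1 fun T _ => hω T

end Thinning

/-! ### The adaptive extraction process -/

section Extraction

variable {V : Type*} [DecidableEq V]

/-- One round: the element named by the strategy `f` is removed from the current set `Q`, and the
rest is intersected with `ω`. -/
def survivors (f : Finset V → V) (ω Q : Finset V) : Finset V := (Q ∩ ω).erase (f Q)

/-- `1` if the strategy `f` fails to name an element of `Q`, and `0` otherwise. -/
def miss (f : Finset V → V) (Q : Finset V) : ℝ := if f Q ∈ Q then 0 else 1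

/-- The expected number of misses in `k` rounds started at `Q`, where the sets `ω` of the rounds
are independent random subsets of `V` of density `p`. -/
noncomputable def expectedMisses [Fintype V] (f : Finset V → V) (p : ℝ) : ℕ → Finset V → ℝ
  | 0, _ => 0
  | k + 1, Q =>
    miss f Q + thin p (fun ω => expectedMisses f p k (survivors f ω Q)) Finset.univ

/-- For each round, whether the strategy named an element of the current set. The list holds the
sets `ω` of the successive rounds. -/
def outcomes (f : Finset V → V) : List (Finset V) → Finset V → List Bool
  | [], _ => []
  | ω :: l, Q => decide (f Q ∈ Q) :: outcomes f l (survivors f ω Q)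

/-- The elements named correctly in the course of the process. -/
def found (f : Finset V → V) : List (Finset V) → Finset V → Finset V
  | [], _ => ∅
  | ω :: l, Q => Q.filter (· = f Q) ∪ found f l (survivors f ω Q)

theorem miss_nonneg (f : Finset V → V) (Q : Finset V) : 0 ≤ miss f Q := by
  unfold miss; split_ifs <;> norm_num

theorem length_outcomes (f : Finset V → V) (l : List (Finset V)) (Q : Finset V) :
    (outcomes f l Q).length = l.length := by
  induction l generalizing Q with
  | nil => rfl
  | cons ω l ih => simp [outcomes, ih]

theorem found_subset (f : Finset V → V) (l : List (Finset V)) (Q : Finset V) :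
    found f l Q ⊆ Q := by
  induction l generalizing Q with
  | nil => simp [found]
  | cons ω l ih =>
    refine Finset.union_subset (Finset.filter_subset _ _) ((ih _).trans ?_)
    exact (Finset.erase_subset _ _).trans Finset.inter_subset_left

theorem card_found (f : Finset V → V) (l : List (Finset V)) (Q : Finset V) :
    (found f l Q).card = (outcomes f l Q).count true := by
  induction l generalizing Q with
  | nil => simp [found, outcomes]
  | cons ω l ih =>
    have hd : Disjoint (Q.filter (· = f Q)) (found f l (survivors f ω Q)) := by
      rw [Finset.disjoint_left]
      intro x hx hx'
      have := found_subset f l _ hx'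
      simp only [survivors, Finset.mem_erase] at this
      exact this.1 (Finset.mem_filter.1 hx).2
    rw [found, outcomes, Finset.card_union_of_disjoint hd, ih, Finset.filter_eq']
    by_cases h : f Q ∈ Q <;> simp [h, add_comm]

/-- The process can be replayed. If a strategy only looks at the part `S \ Q` that has already
left the process, then the record of outcomes together with the elements never named determines
the elements that were named: an element outside `ω` leaves in this round, so it is named now or
never. -/
theorem found_injective (g : Finset V → V) {S S' : Finset V} (l : List (Finset V))
    {Q Q' : Finset V} (hQ : Q ⊆ S) (hQ' : Q' ⊆ S') (hC : S \ Q = S' \ Q')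
    (ho : outcomes (fun T => g (S \ T)) l Q = outcomes (fun T => g (S' \ T)) l Q')
    (hB : Q \ found (fun T => g (S \ T)) l Q = Q' \ found (fun T => g (S' \ T)) l Q') :
    found (fun T => g (S \ T)) l Q = found (fun T => g (S' \ T)) l Q' := by
  induction l generalizing Q Q' with
  | nil => rfl
  | cons ω l ih =>
    simp only [outcomes, List.cons.injEq, decide_eq_decide] at ho
    obtain ⟨hs, ho⟩ := ho
    simp only [found] at hB ⊢
    have hF := found_subset (fun T => g (S \ T)) l (survivors (fun T => g (S \ T)) ω Q)
    have hF' := found_subset (fun T => g (S' \ T)) l (survivors (fun T => g (S' \ T)) ω Q')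
    have hs' : g (S' \ Q') = g (S \ Q) := by rw [hC]
    specialize @ih (survivors (fun T => g (S \ T)) ω Q) (survivors (fun T => g (S' \ T)) ω Q')
    generalize found (fun T => g (S \ T)) l (survivors (fun T => g (S \ T)) ω Q) = F at *
    generalize found (fun T => g (S' \ T)) l (survivors (fun T => g (S' \ T)) ω Q') = F' at *
    simp only [survivors, hs'] at *
    generalize g (S \ Q) = s at *
    simp only [Finset.ext_iff, Finset.subset_iff, Finset.mem_sdiff, Finset.mem_union,
      Finset.mem_filter, Finset.mem_erase, Finset.mem_inter] at *
    have := ih (by grind) (by grind) (by grind) ho (by grind)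
    grind

/-- The expected number of misses of an adaptive strategy is controlled by its miss probability on
non-adaptive random subsets. Before round `r` the current set would be a thinning at rate `p ^ r`
if nothing were removed by the strategy; each removal costs the factor of `thin_erase_le`. -/
theorem expectedMisses_le [Fintype V] (f : Finset V → V) {p : ℝ} (h0 : 0 ≤ p) (h1 : p < 1)
    (k : ℕ) (Q : Finset V) :
    expectedMisses f p k Q ≤
      ∑ r ∈ Finset.range k, (∏ j ∈ Finset.range r, (1 - p ^ (j + 1))⁻¹) *
        thin (p ^ r) (miss f) Q := by
  induction k generalizing Q with
  | zero => simp [expectedMisses]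
  | succ k ih =>
    rw [expectedMisses, Finset.sum_range_succ']
    simp only [Finset.range_zero, Finset.prod_empty, pow_zero, one_mul, thin_one]
    rw [add_comm]
    refine add_le_add_left ?_ _
    refine (thin_mono h0 h1.le fun ω _ => ih (survivors f ω Q)).trans ?_
    rw [thin_sum]
    refine Finset.sum_le_sum fun r _ => ?_
    rw [thin_const_mul, Finset.prod_range_succ, mul_assoc]
    have hp : p ^ (r + 1) < 1 := pow_lt_one₀ h0 h1 (by simp)
    refine mul_le_mul_of_nonneg_left ?_ (Finset.prod_nonneg fun j _ =>
      inv_nonneg.2 (sub_nonneg.2 (pow_le_one₀ h0 h1.le)))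
    have h2 : ∀ ω, survivors f ω Q = Q.erase (f Q) ∩ ω := fun ω => by
      simp [survivors, Finset.erase_inter]
    simp only [h2]
    rw [thin_inter, Finset.inter_univ, thin_thin, ← pow_succ']
    exact thin_erase_le (pow_nonneg h0 _) hp (miss_nonneg f) Q (f Q)

/-- One sequence of sets `ω` serves a whole weighted family of processes at least as well as random
sets do on average. -/
theorem exists_misses_le [Fintype V] {ι : Type*} (I : Finset ι) (w : ι → ℝ)
    (f : ι → Finset V → V) {p : ℝ} (h0 : 0 ≤ p) (h1 : p ≤ 1) (k : ℕ) (Q : ι → Finset V) :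
    ∃ l : List (Finset V), l.length = k ∧
      ∑ i ∈ I, w i * ((outcomes (f i) l (Q i)).count false : ℝ) ≤
        ∑ i ∈ I, w i * expectedMisses (f i) p k (Q i) := by
  induction k generalizing Q with
  | zero => exact ⟨[], rfl, by simp [outcomes, expectedMisses]⟩
  | succ k ih =>
    obtain ⟨ω, hω⟩ := exists_le_of_thin_le h0 h1 (F := fun ω =>
      ∑ i ∈ I, w i * expectedMisses (f i) p k (survivors (f i) ω (Q i))) (Q := Finset.univ) le_rfl
    obtain ⟨l, hl, hle⟩ := ih fun i => survivors (f i) ω (Q i)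
    refine ⟨ω :: l, by simp [hl], ?_⟩
    have hc : ∀ i, ((outcomes (f i) (ω :: l) (Q i)).count false : ℝ) =
        miss (f i) (Q i) + (outcomes (f i) l (survivors (f i) ω (Q i))).count false := by
      intro i
      by_cases h : f i (Q i) ∈ Q i <;> simp [outcomes, miss, h, add_comm]
    simp only [hc, expectedMisses, mul_add, Finset.sum_add_distrib]
    refine add_le_add_right ((hle.trans hω).trans_eq ?_) _
    rw [thin_sum]
    simp only [thin_const_mul]

end Extraction

/-! ### The loss from adaptivity -/

/-- The expansion `-log (1 - u) = ∑ u ^ (t + 1) / (t + 1)` at `u = p ^ (j + 1)`, summed over `j`,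
is a sum over `t` of terms at most `p / (1 - p) / (t + 1) ^ 2`. -/
theorem prod_inv_one_sub_pow_le {p : ℝ} (h0 : 0 ≤ p) (h1 : p < 1) (r : ℕ) :
    ∏ j ∈ Finset.range r, (1 - p ^ (j + 1))⁻¹ ≤ Real.exp (2 * (p / (1 - p))) := by
  have hp : ∀ j : ℕ, p ^ (j + 1) < 1 := fun j => pow_lt_one₀ h0 h1 (by simp)
  have hpos : ∀ j : ℕ, 0 < 1 - p ^ (j + 1) := fun j => sub_pos.2 (hp j)
  rw [← Real.exp_log (Finset.prod_pos fun j _ => inv_pos.2 (hpos j)), Real.exp_le_exp,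
    Real.log_prod fun j _ => (inv_pos.2 (hpos j)).ne']
  simp only [Real.log_inv]
  have hs : HasSum (fun t : ℕ => ∑ j ∈ Finset.range r, (p ^ (j + 1)) ^ (t + 1) / ((t : ℝ) + 1))
      (∑ j ∈ Finset.range r, -Real.log (1 - p ^ (j + 1))) :=
    hasSum_sum fun j _ => Real.hasSum_pow_div_log_of_abs_lt_one
      (by rw [abs_of_nonneg (pow_nonneg h0 _)]; exact hp j)
  have hz : HasSum (fun t : ℕ => p / (1 - p) * (1 / ((t : ℝ) + 1) ^ 2))
      (p / (1 - p) * (Real.pi ^ 2 / 6)) := by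
    have := (hasSum_nat_add_iff' 1).2 hasSum_zeta_two
    simpa using this.mul_left (p / (1 - p))
  have h2 : 0 < 1 - p := sub_pos.2 h1
  refine (hasSum_le (fun t => ?_) hs hz).trans ?_
  · have ht : 0 < 1 - p ^ (t + 1) := hpos t
    have hgeom : ∑ j ∈ Finset.range r, (p ^ (j + 1)) ^ (t + 1) ≤
        p ^ (t + 1) / (1 - p ^ (t + 1)) := by
      have : ∀ j : ℕ, (p ^ (j + 1)) ^ (t + 1) = p ^ (t + 1) * (p ^ (t + 1)) ^ j := fun j => by
        rw [← pow_mul, ← pow_mul, ← pow_add]; ring_nf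
      simp only [this]
      rw [← Finset.mul_sum, div_eq_mul_inv]
      refine mul_le_mul_of_nonneg_left ?_ (pow_nonneg h0 _)
      rw [← tsum_geometric_of_lt_one (pow_nonneg h0 _) (hp t)]
      exact (summable_geometric_of_lt_one (pow_nonneg h0 _) (hp t)).sum_le_tsum _
        fun i _ => pow_nonneg (pow_nonneg h0 _) _
    -- `1 - p ^ (t + 1) = (1 - p) * ∑ i ≤ t, p ^ i`, and each of the `t + 1` terms is `≥ p ^ t`.
    have hlow : ((t : ℝ) + 1) * p ^ t * (1 - p) ≤ 1 - p ^ (t + 1) := by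
      rw [← geom_sum_mul_neg]
      refine mul_le_mul_of_nonneg_right ?_ h2.le
      calc ((t : ℝ) + 1) * p ^ t = ∑ i ∈ Finset.range (t + 1), p ^ t := by simp
        _ ≤ _ := Finset.sum_le_sum fun i hi =>
          pow_le_pow_of_le_one h0 h1.le (by simp at hi; omega)
    have ht1 : (0 : ℝ) < t + 1 := by positivity
    rw [← Finset.sum_div, div_le_iff₀ ht1]
    refine hgeom.trans ?_
    rw [div_le_iff₀ ht]
    have : p / (1 - p) * (1 / ((t : ℝ) + 1) ^ 2) * (t + 1) * (1 - p ^ (t + 1)) ≥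
        p / (1 - p) * (1 / ((t : ℝ) + 1) ^ 2) * (t + 1) * (((t : ℝ) + 1) * p ^ t * (1 - p)) :=
      mul_le_mul_of_nonneg_left hlow (by positivity)
    refine le_trans (le_of_eq ?_) this
    rw [pow_succ']
    field_simp
  · have : Real.pi ^ 2 / 6 ≤ 2 := by nlinarith [Real.pi_lt_d2, Real.pi_pos]
    rw [mul_comm]
    exact mul_le_mul_of_nonneg_right this (by positivity)

/-! ### Counting -/

section Counting

variable {V : Type*} [DecidableEq V] [Fintype V]

theorem thin_univ (q : ℝ) (h : Finset V → ℝ) :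
    thin q h Finset.univ = ∑ S, q ^ S.card * (1 - q) ^ (Finset.univ \ S).card * h S := by
  simp [thin]

theorem exists_finset_length_le (s : ℕ) :
    ∃ M : Finset (List Bool), (∀ m, m ∈ M ↔ m.length ≤ s) ∧ M.card ≤ 2 ^ (s + 1) := by
  classical
  refine ⟨(Finset.range (s + 1)).biUnion fun i =>
    Finset.univ.image fun v : Fin i → Bool => List.ofFn v, fun m => ?_, ?_⟩
  · simp only [Finset.mem_biUnion, Finset.mem_range, Finset.mem_image, Finset.mem_univ, true_and]
    constructor
    · rintro ⟨i, hi, v, rfl⟩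
      simp; omega
    · intro h
      exact ⟨m.length, by omega, m.get, List.ofFn_get m⟩
  · refine Finset.card_biUnion_le.trans ?_
    calc ∑ i ∈ Finset.range (s + 1), (Finset.univ.image fun v : Fin i → Bool => List.ofFn v).card
        ≤ ∑ i ∈ Finset.range (s + 1), 2 ^ i :=
          Finset.sum_le_sum fun i _ => Finset.card_image_le.trans (by simp)
      _ ≤ 2 ^ (s + 1) := by
          have := Nat.geomSum_lt (m := 2) (n := s + 1) (s := Finset.range (s + 1)) le_rfl
            (by simp)
          exact this.le

theorem exists_finset_length_eq (R : ℕ) :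
    ∃ M : Finset (List Bool), (∀ m, m ∈ M ↔ m.length = R) ∧ M.card ≤ 2 ^ R := by
  classical
  refine ⟨Finset.univ.image fun v : Fin R → Bool => List.ofFn v, fun m => ?_,
    Finset.card_image_le.trans (by simp)⟩
  simp only [Finset.mem_image, Finset.mem_univ, true_and]
  constructor
  · rintro ⟨v, rfl⟩; simp
  · rintro rfl; exact ⟨m.get, List.ofFn_get m⟩

/-- The strategy of a receiver who holds the message of `S`, knows the size of `S`, and is shown the
part of `S` that has left the process. -/
def receiver {M : Type*} (a : Finset V → M) (g : M → ℕ → Finset V → V) (S T : Finset V) : V :=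
  g (a S) S.card (S \ T)

/-- The encoding argument. A set `S` is determined by its message, the outcomes of the rounds and
the set `B` of elements that were never named; if `k` elements were named, the weight of `S` under
the density `θ` is `(θ / (1 - θ)) ^ k` times that of `B`. -/
theorem sum_weight_le_of_many_found {a : Finset V → List Bool} {g : List Bool → ℕ → Finset V → V}
    {s : ℕ} (ha : ∀ S, (a S).length ≤ s) {θ : ℝ} (h0 : 0 ≤ θ) (h1 : θ ≤ 1 / 2)
    (l : List (Finset V)) (k : ℕ) (good : Finset (Finset V))
    (hgood : ∀ S ∈ good, k ≤ (found (receiver a g S) l S).card) :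
    ∑ S ∈ good, θ ^ S.card * (1 - θ) ^ (Finset.univ \ S).card ≤
      2 ^ (s + 1) * 2 ^ l.length * (θ / (1 - θ)) ^ k := by
  classical
  obtain ⟨M, hM, hMc⟩ := exists_finset_length_le s
  obtain ⟨O, hO, hOc⟩ := exists_finset_length_eq l.length
  have h2 : 0 < 1 - θ := by linarith
  set ρ := θ / (1 - θ) with hρ
  have hρ0 : 0 ≤ ρ := by positivity
  have hρ1 : ρ ≤ 1 := by rw [hρ, div_le_one h2]; linarith
  let w : Finset V → ℝ := fun S => θ ^ S.card * (1 - θ) ^ (Finset.univ \ S).card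
  have hw0 : ∀ S, 0 ≤ w S := fun S => by positivity
  have hw1 : ∑ S, w S = 1 := by
    have := thin_univ θ fun _ : Finset V => (1 : ℝ)
    rw [thin_const] at this
    simpa [w] using this.symm
  let code : Finset V → (List Bool × List Bool) × Finset V := fun S =>
    ((a S, outcomes (receiver a g S) l S), S \ found (receiver a g S) l S)
  have hinj : Function.Injective code := by
    intro S S' h
    simp only [code, Prod.mk.injEq] at h
    obtain ⟨⟨hm, ho⟩, hB⟩ := h
    have hcard : S.card = S'.card := by
      rw [← Finset.card_sdiff_add_card_eq_card (found_subset (receiver a g S) l S),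
        ← Finset.card_sdiff_add_card_eq_card (found_subset (receiver a g S') l S'),
        card_found, card_found, ho, hB]
    have hr : receiver a g S' = fun T => g (a S) S.card (S' \ T) := by
      funext T; simp [receiver, hm, hcard]
    rw [hr] at ho hB
    have := found_injective (g (a S) S.card) l (Finset.Subset.refl S) (Finset.Subset.refl S')
      (by simp) ho hB
    rw [← Finset.sdiff_union_of_subset (found_subset (receiver a g S) l S),
      ← Finset.sdiff_union_of_subset (found_subset (receiver a g S') l S'), hr]
    exact congrArg₂ (· ∪ ·) hB this
  have hweight : ∀ S ∈ good, w S ≤ ρ ^ k * w (code S).2 := by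
    intro S hS
    have hsub := found_subset (receiver a g S) l S
    have e1 : S.card = (S \ found (receiver a g S) l S).card +
        (found (receiver a g S) l S).card := (Finset.card_sdiff_add_card_eq_card hsub).symm
    have e2 : (Finset.univ \ (S \ found (receiver a g S) l S)).card =
        (Finset.univ \ S).card + (found (receiver a g S) l S).card := by
      have c1 := Finset.card_sdiff_add_card_eq_card (Finset.subset_univ S)
      have c2 := Finset.card_sdiff_add_card_eq_card
        (Finset.subset_univ (S \ found (receiver a g S) l S))
      omega
    have e3 : w S = ρ ^ (found (receiver a g S) l S).card * w (code S).2 := by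
      simp only [w, code]
      rw [e2, hρ, div_pow]
      conv_lhs => rw [e1]
      rw [pow_add, pow_add]
      field_simp
    rw [e3]
    exact mul_le_mul_of_nonneg_right (pow_le_pow_of_le_one hρ0 hρ1 (hgood S hS)) (hw0 _)
  calc ∑ S ∈ good, w S ≤ ∑ S ∈ good, ρ ^ k * w (code S).2 := Finset.sum_le_sum hweight
    _ = ρ ^ k * ∑ c ∈ good.image code, w c.2 := by
        rw [Finset.sum_image hinj.injOn, Finset.mul_sum]
    _ ≤ ρ ^ k * ∑ c ∈ (M ×ˢ O) ×ˢ Finset.univ, w c.2 := by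
        refine mul_le_mul_of_nonneg_left
          (Finset.sum_le_sum_of_subset_of_nonneg ?_ fun c _ _ => hw0 _) (by positivity)
        intro c hc
        obtain ⟨S, -, rfl⟩ := Finset.mem_image.1 hc
        simp [code, hM, hO, ha, length_outcomes]
    _ = ρ ^ k * (M.card * O.card) := by
        rw [Finset.sum_product]
        simp [hw1]
    _ ≤ ρ ^ k * (2 ^ (s + 1) * 2 ^ l.length) := by
        gcongr
        · exact_mod_cast hMc
        · exact_mod_cast hOc
    _ = _ := by ring

end Counting

/-! ### Fixing the public coins -/

theorem exists_sum_indicator_le {Ω ι : Type*} [MeasurableSpace Ω] (μ : Measure Ω)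
    [IsProbabilityMeasure μ] (I : Finset ι) (c : ι → ℝ) (hc : ∀ i ∈ I, 0 ≤ c i)
    (E : ι → Set Ω) {δ : ℝ} (hδ : 0 ≤ δ)
    (hE : ∀ i ∈ I, c i ≠ 0 → μ (E i) ≤ ENNReal.ofReal δ) :
    ∃ r, ∑ i ∈ I, c i * (E i).indicator 1 r ≤ δ * ∑ i ∈ I, c i := by
  -- Measurable hulls make the integral additive whether or not the events are measurable.
  let F : Ω → ℝ≥0∞ := fun r =>
    ∑ i ∈ I, ENNReal.ofReal (c i) * (toMeasurable μ (E i)).indicator 1 r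
  have hm : ∀ i, Measurable ((toMeasurable μ (E i)).indicator (1 : Ω → ℝ≥0∞)) := fun i =>
    measurable_one.indicator (measurableSet_toMeasurable μ (E i))
  have hF : Measurable F := Finset.measurable_sum _ fun i _ => (hm i).const_mul _
  obtain ⟨r, hr⟩ := exists_le_lintegral (μ := μ) hF.aemeasurable
  refine ⟨r, ?_⟩
  have hint : ∫⁻ r, F r ∂μ ≤ ENNReal.ofReal (δ * ∑ i ∈ I, c i) := by
    rw [lintegral_finsetSum _ fun i _ => (hm i).const_mul _, Finset.mul_sum,
      ENNReal.ofReal_sum_of_nonneg fun i hi => mul_nonneg hδ (hc i hi)]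
    refine Finset.sum_le_sum fun i hi => ?_
    rw [lintegral_const_mul _ (hm i),
      lintegral_indicator_one (measurableSet_toMeasurable μ (E i)), measure_toMeasurable,
      ENNReal.ofReal_mul hδ, mul_comm]
    by_cases h : c i = 0
    · simp [h]
    · exact mul_le_mul_left (hE i hi h) _
  have hlow : ENNReal.ofReal (∑ i ∈ I, c i * (E i).indicator 1 r) ≤ F r := by
    have hnn : ∀ i ∈ I, 0 ≤ c i * (E i).indicator 1 r := fun i hi =>
      mul_nonneg (hc i hi) (Set.indicator_nonneg (fun _ _ => zero_le_one) _)
    rw [ENNReal.ofReal_sum_of_nonneg hnn]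
    refine Finset.sum_le_sum fun i hi => ?_
    by_cases h : r ∈ E i
    · simp [h, subset_toMeasurable μ (E i) h]
    · simp [h]
  exact (ENNReal.ofReal_le_ofReal_iff (mul_nonneg hδ (Finset.sum_nonneg hc))).1
    ((hlow.trans hr).trans hint)

section Protocol

variable {n : ℕ}

/-- The characteristic vector of a set. -/
def indicatorVec (S : Finset (Fin n)) : Fin n → Bool := fun i => decide (i ∈ S)

@[simp] theorem bitSupport_indicatorVec (S : Finset (Fin n)) :
    bitSupport (indicatorVec S) = S := by
  ext i; simp [bitSupport, indicatorVec]

/-- Alice's message on a set, when the coins are `r`. -/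
def OneWayProtocol.message (P : OneWayProtocol (Fin n → Bool) ((Fin n → Bool) × ℕ) (Fin n))
    (r : P.Coins) (S : Finset (Fin n)) : List Bool :=
  P.alice r (indicatorVec S)

/-- Bob's answer on a message, the size of Alice's set and a subset of it, when the coins
are `r`. -/
def OneWayProtocol.answer (P : OneWayProtocol (Fin n → Bool) ((Fin n → Bool) × ℕ) (Fin n))
    (r : P.Coins) (m : List Bool) (k : ℕ) (C : Finset (Fin n)) : Fin n :=
  P.bob r m (indicatorVec C, k)

theorem measure_receiver_notMem_le
    {P : OneWayProtocol (Fin n → Bool) ((Fin n → Bool) × ℕ) (Fin n)} {δ : ℝ}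
    (hP : P.Solves (URsub n) δ) {S T : Finset (Fin n)} (hT : T ⊆ S) (hne : T ≠ ∅) :
    P.μ {r | receiver (P.message r) (P.answer r) S T ∉ T} ≤ ENNReal.ofReal δ := by
  have hprom : (URsub n).promise (indicatorVec S) (indicatorVec (S \ T), S.card) := by
    simp only [URsub, bitSupport_indicatorVec, and_true]
    exact Finset.sdiff_ssubset hT (Finset.nonempty_iff_ne_empty.2 hne)
  refine (measure_mono fun r hr => ?_).trans (hP _ _ hprom)
  simp only [Set.mem_ofPred_eq, URsub, OneWayProtocol.output, receiver, OneWayProtocol.message,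
    OneWayProtocol.answer, ne_eq, not_not, indicatorVec, decide_eq_decide] at hr ⊢
  have := @hT
  grind

/-- Some outcome of the coins makes the receiver miss rarely on non-adaptive random inputs, on
average over a random set `S` of density `θ`. An empty current set is always missed, which accounts
for the exponential term. -/
theorem exists_coins_sum_thin_miss_le
    {P : OneWayProtocol (Fin n → Bool) ((Fin n → Bool) × ℕ) (Fin n)} {δ : ℝ} (hδ : 0 ≤ δ)
    (hP : P.Solves (URsub n) δ) {θ p : ℝ} (hθ0 : 0 ≤ θ) (hθ1 : θ ≤ 1) (hp0 : 0 ≤ p) (hp1 : p ≤ 1)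
    (R : ℕ) :
    ∃ r : P.Coins, ∑ S, θ ^ S.card * (1 - θ) ^ (Finset.univ \ S).card *
        ∑ i ∈ Finset.range R, thin (p ^ i) (miss (receiver (P.message r) (P.answer r) S)) S ≤
      R * (Real.exp (-(θ * p ^ R * n)) + δ) := by
  classical
  let _ := P.mCoins
  have _ := P.isProb
  let w : Finset (Fin n) → ℝ := fun S => θ ^ S.card * (1 - θ) ^ (Finset.univ \ S).card
  have hθ2 : 0 ≤ 1 - θ := sub_nonneg.2 hθ1
  have hw0 : ∀ S, 0 ≤ w S := fun S => by positivity
  have hw : ∀ h : Finset (Fin n) → ℝ, ∑ S, w S * h S = thin θ h Finset.univ :=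
    fun h => (thin_univ θ h).symm
  have hpi0 : ∀ i, 0 ≤ p ^ i := fun i => pow_nonneg hp0 i
  have hpi1 : ∀ i, p ^ i ≤ 1 := fun i => pow_le_one₀ hp0 hp1
  have hpi2 : ∀ i, 0 ≤ 1 - p ^ i := fun i => sub_nonneg.2 (hpi1 i)
  -- The coefficient of the query `T` in round `i`.
  let c : Finset (Fin n) × ℕ × Finset (Fin n) → ℝ := fun j =>
    w j.1 * if j.2.2 ⊆ j.1 then
      (p ^ j.2.1) ^ j.2.2.card * (1 - p ^ j.2.1) ^ (j.1 \ j.2.2).card *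
        (if j.2.2 = ∅ then 0 else 1) else 0
  have hc0 : ∀ j, 0 ≤ c j := fun j => by
    have := hpi2 j.2.1
    refine mul_nonneg (hw0 _) ?_
    split_ifs <;> positivity
  let I : Finset (Finset (Fin n) × ℕ × Finset (Fin n)) :=
    Finset.univ ×ˢ Finset.range R ×ˢ Finset.univ
  have hcsum : ∀ h : Finset (Fin n) → Finset (Fin n) → ℝ,
      ∑ j ∈ I, c j * h j.1 j.2.2 = ∑ S, w S * ∑ i ∈ Finset.range R,
        thin (p ^ i) (fun T => if T = ∅ then 0 else h S T) S := by
    intro h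
    simp only [I, Finset.sum_product, c, thin]
    refine Finset.sum_congr rfl fun S _ => ?_
    rw [Finset.mul_sum]
    refine Finset.sum_congr rfl fun i _ => ?_
    rw [Finset.mul_sum, ← Finset.sum_subset (Finset.subset_univ S.powerset)]
    · refine Finset.sum_congr rfl fun T hT => ?_
      rw [if_pos (Finset.mem_powerset.1 hT)]
      split_ifs <;> ring
    · intro T _ hT
      rw [if_neg fun h' => hT (Finset.mem_powerset.2 h')]
      ring
  obtain ⟨r, hr⟩ := exists_sum_indicator_le P.μ I c (fun j _ => hc0 j)
    (fun j => {r | receiver (P.message r) (P.answer r) j.1 j.2.2 ∉ j.2.2}) hδ (by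
      intro j _ hj
      refine measure_receiver_notMem_le hP (by_contra fun h => hj ?_) fun h => hj ?_
      · simp [c, h]
      · simp [c, h])
  refine ⟨r, ?_⟩
  have hind : ∀ j : Finset (Fin n) × ℕ × Finset (Fin n),
      ({r | receiver (P.message r) (P.answer r) j.1 j.2.2 ∉ j.2.2} : Set P.Coins).indicator
        (1 : P.Coins → ℝ) r = miss (receiver (P.message r) (P.answer r) j.1) j.2.2 := by
    intro j
    by_cases h : receiver (P.message r) (P.answer r) j.1 j.2.2 ∈ j.2.2 <;> simp [miss, h]
  simp only [hind] at hr
  rw [hcsum fun S T => miss (receiver (P.message r) (P.answer r) S) T] at hr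
  have hcle : ∑ j ∈ I, c j ≤ R := by
    have := hcsum fun _ _ => 1
    simp only [mul_one] at this
    rw [this, hw]
    refine (thin_mono hθ0 hθ1 (h' := fun _ => (R : ℝ)) fun S _ => ?_).trans_eq (thin_const _ _ _)
    refine (Finset.sum_le_sum (g := fun _ => (1 : ℝ)) fun i _ => ?_).trans_eq (by simp)
    refine (thin_mono (hpi0 i) (hpi1 i) (h' := fun _ => (1 : ℝ)) fun T _ => ?_).trans_eq
      (thin_const _ _ _)
    split_ifs <;> norm_num
  have hempty : ∑ S, w S * ∑ i ∈ Finset.range R,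
      thin (p ^ i) (fun T => if T = ∅ then 1 else 0) S ≤ R * Real.exp (-(θ * p ^ R * n)) := by
    rw [hw, thin_sum]
    refine (Finset.sum_le_sum (g := fun _ => Real.exp (-(θ * p ^ R * n))) fun i hi => ?_).trans_eq
      (by simp)
    have e : thin θ (thin (p ^ i) fun T => if T = ∅ then 1 else 0)
        (Finset.univ : Finset (Fin n)) = (1 - θ * p ^ i) ^ n := by
      rw [thin_thin, thin_ite_empty]; simp
    rw [e]
    have hle : θ * p ^ R ≤ θ * p ^ i := mul_le_mul_of_nonneg_left
      (pow_le_pow_of_le_one hp0 hp1 (Finset.mem_range.1 hi).le) hθ0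
    calc (1 - θ * p ^ i) ^ n ≤ Real.exp (-(θ * p ^ i)) ^ n := by
          refine pow_le_pow_left₀ (sub_nonneg.2 (mul_le_one₀ hθ1 (hpi0 i) (hpi1 i))) ?_ _
          linarith [Real.add_one_le_exp (-(θ * p ^ i))]
      _ = Real.exp (-(θ * p ^ i * n)) := by rw [← Real.exp_nat_mul]; ring_nf
      _ ≤ _ := Real.exp_le_exp.2 (by
          have := mul_le_mul_of_nonneg_right hle (Nat.cast_nonneg (α := ℝ) n)
          linarith)
  have hsplit : ∑ S, w S * ∑ i ∈ Finset.range R,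
        thin (p ^ i) (miss (receiver (P.message r) (P.answer r) S)) S =
      ∑ S, w S * ∑ i ∈ Finset.range R, thin (p ^ i) (fun T => if T = ∅ then 1 else 0) S +
      ∑ S, w S * ∑ i ∈ Finset.range R, thin (p ^ i)
        (fun T => if T = ∅ then 0 else miss (receiver (P.message r) (P.answer r) S) T) S := by
    rw [← Finset.sum_add_distrib]
    refine Finset.sum_congr rfl fun S _ => ?_
    rw [← mul_add, ← Finset.sum_add_distrib]
    congr 1
    refine Finset.sum_congr rfl fun i _ => ?_
    rw [← thin_add]
    refine thin_congr fun T _ => ?_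
    by_cases h : T = ∅
    · subst h; simp [miss]
    · simp [h]
  refine hsplit.trans_le ?_
  have := mul_le_mul_of_nonneg_left hcle hδ
  linarith

/-- The trade-off between message length and the parameters of the extraction process: if the
expected number of misses in `R` rounds is at most `R / 8`, then half of the sets `S`, by weight,
lose at least `3 * R / 4` elements in the encoding. -/
theorem half_le_of_solves
    {P : OneWayProtocol (Fin n → Bool) ((Fin n → Bool) × ℕ) (Fin n)} {δ : ℝ} (hδ : 0 ≤ δ)
    (hP : P.Solves (URsub n) δ) {s : ℕ} (hs : ∀ r x, (P.alice r x).length ≤ s)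
    {θ p : ℝ} (hθ0 : 0 ≤ θ) (hθ1 : θ ≤ 1 / 2) (hp0 : 0 ≤ p) (hp1 : p < 1) {R k : ℕ} (hR : 0 < R)
    (hk : 4 * k ≤ 3 * R + 3)
    (hmiss : Real.exp (2 * (p / (1 - p))) * (Real.exp (-(θ * p ^ R * n)) + δ) ≤ 1 / 8) :
    1 / 2 ≤ (2 : ℝ) ^ (s + 1) * 2 ^ R * (θ / (1 - θ)) ^ k := by
  classical
  obtain ⟨r, hr⟩ := exists_coins_sum_thin_miss_le hδ hP hθ0 (by linarith) hp0 hp1.le R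
  let w : Finset (Fin n) → ℝ := fun S => θ ^ S.card * (1 - θ) ^ (Finset.univ \ S).card
  let f : Finset (Fin n) → Finset (Fin n) → Fin n := receiver (P.message r) (P.answer r)
  change ∑ S, w S * ∑ i ∈ Finset.range R, thin (p ^ i) (miss (f S)) S ≤ _ at hr
  have hθ2 : 0 ≤ 1 - θ := by linarith
  have hw0 : ∀ S, 0 ≤ w S := fun S => by positivity
  have hw1 : ∑ S, w S = 1 := by
    have := thin_univ θ fun _ : Finset (Fin n) => (1 : ℝ)
    rw [thin_const] at this
    simpa [w] using this.symm
  obtain ⟨l, hl, hle⟩ := exists_misses_le Finset.univ w f hp0 hp1.le R id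
  have hR' : (0 : ℝ) < R := by exact_mod_cast hR
  have hexp : ∑ S, w S * expectedMisses (f S) p R S ≤ R / 8 := by
    have h1 : ∀ S, expectedMisses (f S) p R S ≤ Real.exp (2 * (p / (1 - p))) *
        ∑ i ∈ Finset.range R, thin (p ^ i) (miss (f S)) S := by
      intro S
      refine (expectedMisses_le (f S) hp0 hp1 R S).trans ?_
      rw [Finset.mul_sum]
      exact Finset.sum_le_sum fun i _ => mul_le_mul_of_nonneg_right
        (prod_inv_one_sub_pow_le hp0 hp1 i)
        (thin_nonneg (pow_nonneg hp0 i) (pow_le_one₀ hp0 hp1.le) (miss_nonneg _) S)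
    calc ∑ S, w S * expectedMisses (f S) p R S
        ≤ ∑ S, w S * (Real.exp (2 * (p / (1 - p))) *
            ∑ i ∈ Finset.range R, thin (p ^ i) (miss (f S)) S) :=
          Finset.sum_le_sum fun S _ => mul_le_mul_of_nonneg_left (h1 S) (hw0 S)
      _ = Real.exp (2 * (p / (1 - p))) *
            ∑ S, w S * ∑ i ∈ Finset.range R, thin (p ^ i) (miss (f S)) S := by
          rw [Finset.mul_sum]
          exact Finset.sum_congr rfl fun S _ => by ring
      _ ≤ Real.exp (2 * (p / (1 - p))) * (R * (Real.exp (-(θ * p ^ R * n)) + δ)) :=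
          mul_le_mul_of_nonneg_left hr (Real.exp_pos _).le
      _ ≤ R / 8 := by nlinarith
  let N : Finset (Fin n) → ℕ := fun S => (outcomes (f S) l S).count false
  let good : Finset (Finset (Fin n)) := Finset.univ.filter fun S => 4 * N S ≤ R
  -- Markov's inequality for the number of misses.
  have hbad : ∑ S ∈ Finset.univ.filter (fun S => ¬ 4 * N S ≤ R), w S ≤ 1 / 2 := by
    have h2 : ∑ S ∈ Finset.univ.filter (fun S => ¬ 4 * N S ≤ R), R * w S ≤
        ∑ S, 4 * (w S * N S) := by
      refine (Finset.sum_le_sum fun S hS => ?_).trans (Finset.sum_le_sum_of_subset_of_nonneg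
        (Finset.filter_subset _ _) fun S _ _ => ?_)
      · have : (R : ℝ) ≤ 4 * N S := by
          have := (Finset.mem_filter.1 hS).2
          exact_mod_cast (not_le.1 this).le
        nlinarith [hw0 S]
      · have := hw0 S
        positivity
    rw [← Finset.mul_sum, ← Finset.mul_sum] at h2
    have h3 : ∑ S, w S * (N S : ℝ) ≤ R / 8 := hle.trans hexp
    by_contra hcon
    nlinarith [mul_lt_mul_of_pos_left (not_le.1 hcon) hR']
  have hgood : 1 / 2 ≤ ∑ S ∈ good, w S := by
    have := Finset.sum_filter_add_sum_filter_not Finset.univ (fun S => 4 * N S ≤ R) w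
    change ∑ S ∈ good, w S + _ = _ at this
    linarith
  rw [← hl]
  refine hgood.trans (sum_weight_le_of_many_found (a := P.message r) (g := P.answer r)
    (fun S => hs r _) hθ0 hθ1 l k good fun S hS => ?_)
  have h4 : 4 * N S ≤ R := (Finset.mem_filter.1 hS).2
  have h5 := List.count_true_add_count_false (outcomes (f S) l S)
  rw [length_outcomes, hl] at h5
  rw [card_found]
  change k ≤ (outcomes (f S) l S).count true
  change 4 * (outcomes (f S) l S).count false ≤ R at h4
  omega

end Protocol

/-! ### Choice of parameters -/

/-- With `N = n / L`, the sets `S` have odds `1 / √N` per element, `p / (1 - p) = L / 8` keeps the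
loss from adaptivity below `exp (L / 4)`, and the process stops after about `(L / 16) * log N`
rounds, when about `L` elements are still left. -/
theorem exists_parameters {n : ℕ} {L N b δ : ℝ} (hL : 64 ≤ L) (hN64 : 64 ≤ N)
    (hnN : (n : ℝ) = L * N) (hb6 : 6 ≤ b) (hlogN : Real.log N = b * Real.log 2)
    (hδ : δ ≤ Real.exp (-(L / 2))) :
    ∃ (θ p : ℝ) (R k : ℕ), 0 ≤ θ ∧ θ ≤ 1 / 2 ∧ 0 ≤ p ∧ p < 1 ∧ L * b / 32 - 1 ≤ R ∧
      4 * k ≤ 3 * R + 3 ∧ 3 * R ≤ 4 * k ∧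
      Real.exp (2 * (p / (1 - p))) * (Real.exp (-(θ * p ^ R * n)) + δ) ≤ 1 / 8 ∧
      θ / (1 - θ) = Real.exp (-(Real.log N / 2)) := by
  have hL0 : 0 < L := by linarith
  have hN0 : 0 < N := by linarith
  have hlog2 : 1 / 2 < Real.log 2 := by linarith [Real.log_two_gt_d9]
  have hb0 : 0 < b := by linarith
  have hlogN0 : 0 < Real.log N := by rw [hlogN]; exact mul_pos hb0 (by linarith)
  obtain ⟨ρ, hρ⟩ : ∃ ρ, ρ = Real.exp (-(Real.log N / 2)) := ⟨_, rfl⟩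
  have hρ0 : 0 < ρ := hρ ▸ Real.exp_pos _
  have hρ1 : ρ ≤ 1 := by rw [hρ, Real.exp_le_one_iff]; linarith
  have hρN : ρ * ρ * N = 1 := by
    have e : N = Real.exp (Real.log N) := (Real.exp_log hN0).symm
    rw [hρ, ← Real.exp_add]
    nth_rewrite 3 [e]
    rw [← Real.exp_add]
    ring_nf
    exact Real.exp_zero
  obtain ⟨θ, hθ⟩ : ∃ θ, θ = ρ / (1 + ρ) := ⟨_, rfl⟩
  have hθρ : ρ / 2 ≤ θ := by
    rw [hθ, div_le_div_iff₀ (by norm_num) (by linarith)]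
    exact mul_le_mul_of_nonneg_left (by linarith) hρ0.le
  have hθ1 : θ ≤ 1 / 2 := by
    rw [hθ, div_le_div_iff₀ (by linarith) (by norm_num)]; linarith
  have hθdiv : θ / (1 - θ) = ρ := by
    rw [hθ]; field_simp; ring
  obtain ⟨K, hK⟩ : ∃ K, K = L / 8 := ⟨_, rfl⟩
  have hK0 : 0 < K := by linarith
  obtain ⟨p, hp⟩ : ∃ p, p = K / (K + 1) := ⟨_, rfl⟩
  have hp0 : 0 < p := hp ▸ by positivity
  have hp1 : p < 1 := by rw [hp, div_lt_one (by linarith)]; linarith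
  have hpdiv : p / (1 - p) = K := by rw [hp]; field_simp; ring
  obtain ⟨R, hR⟩ : ∃ R, R = ⌊K * Real.log N / 2⌋₊ := ⟨_, rfl⟩
  have hx : L * b / 32 ≤ K * Real.log N / 2 := by
    have := mul_le_mul_of_nonneg_left hlog2.le (mul_pos hL0 hb0).le
    have e : K * Real.log N / 2 = L * b * Real.log 2 / 16 := by rw [hlogN, hK]; ring
    linarith
  have hRle : (R : ℝ) ≤ K * Real.log N / 2 := hR ▸ Nat.floor_le (by positivity)
  have hRge : L * b / 32 - 1 ≤ R := by
    have := Nat.lt_floor_add_one (K * Real.log N / 2)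
    rw [← hR] at this
    linarith
  have hpR : ρ ≤ p ^ R := by
    have h1 : Real.exp (-(1 / K)) ≤ p := by
      have e : p = (1 / K + 1)⁻¹ := by rw [hp]; field_simp; ring
      rw [Real.exp_neg, e]
      exact inv_anti₀ (by positivity) (Real.add_one_le_exp (1 / K))
    calc ρ = Real.exp (-(Real.log N / 2)) := hρ
      _ ≤ Real.exp (R * -(1 / K)) := by
          refine Real.exp_le_exp.2 ?_
          have : (R : ℝ) * (1 / K) ≤ K * Real.log N / 2 * (1 / K) :=
            mul_le_mul_of_nonneg_right hRle (by positivity)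
          have e : K * Real.log N / 2 * (1 / K) = Real.log N / 2 := by field_simp
          linarith
      _ = Real.exp (-(1 / K)) ^ R := Real.exp_nat_mul _ _
      _ ≤ p ^ R := pow_le_pow_left₀ (Real.exp_pos _).le h1 R
  have hmiss : Real.exp (2 * (p / (1 - p))) * (Real.exp (-(θ * p ^ R * n)) + δ) ≤ 1 / 8 := by
    have h1 : Real.exp (-(θ * p ^ R * n)) ≤ Real.exp (-(L / 2)) := by
      refine Real.exp_le_exp.2 (neg_le_neg ?_)
      have h2 : ρ / 2 * ρ ≤ θ * p ^ R := mul_le_mul hθρ hpR hρ0.le (by linarith)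
      have h4 := mul_le_mul_of_nonneg_right h2 (Nat.cast_nonneg (α := ℝ) n)
      have h5 : ρ / 2 * ρ * n = L / 2 := by
        rw [hnN]; linear_combination L / 2 * hρN
      linarith
    rw [hpdiv]
    calc Real.exp (2 * K) * (Real.exp (-(θ * p ^ R * n)) + δ)
        ≤ Real.exp (2 * K) * (Real.exp (-(L / 2)) + Real.exp (-(L / 2))) :=
          mul_le_mul_of_nonneg_left (add_le_add h1 hδ) (Real.exp_pos _).le
      _ = 2 * Real.exp (-(L / 4)) := by
          rw [← two_mul, mul_left_comm, ← Real.exp_add, hK]; ring_nf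
      _ ≤ 2 * Real.exp (-16) := by
          have : Real.exp (-(L / 4)) ≤ Real.exp (-16) := Real.exp_le_exp.2 (by linarith)
          linarith
      _ ≤ 1 / 8 := by
          have := Real.add_one_le_exp (16 : ℝ)
          rw [Real.exp_neg, ← div_eq_mul_inv, div_le_div_iff₀ (Real.exp_pos _) (by norm_num)]
          linarith
  exact ⟨θ, p, R, (3 * R + 3) / 4, by linarith, hθ1, hp0.le, hp1, hRge, by omega, by omega,
    hmiss, hθdiv.trans hρ⟩

theorem length_ge_of_solves {n : ℕ}
    {P : OneWayProtocol (Fin n → Bool) ((Fin n → Bool) × ℕ) (Fin n)} {δ : ℝ} (hδ : 0 < δ)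
    (hL : 64 ≤ Real.logb 2 (1 / δ)) (hn : Real.logb 2 (1 / δ) ≤ (n : ℝ) / 64)
    (hP : P.Solves (URsub n) δ) {s : ℕ} (hs : ∀ r x, (P.alice r x).length ≤ s) :
    1 / 512 * (Real.logb 2 (1 / δ) * (Real.logb 2 ((n : ℝ) / Real.logb 2 (1 / δ))) ^ 2) ≤ s := by
  have hlog2 : 1 / 2 < Real.log 2 := by linarith [Real.log_two_gt_d9]
  have hlog0 : Real.log 2 ≠ 0 := by linarith
  have hδL : δ = Real.exp (-(Real.logb 2 (1 / δ) * Real.log 2)) := by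
    rw [Real.logb, one_div, Real.log_inv, div_mul_cancel₀ _ hlog0, neg_neg, Real.exp_log hδ]
  generalize Real.logb 2 (1 / δ) = L at *
  have hL0 : 0 < L := by linarith
  have hδ2 : δ ≤ Real.exp (-(L / 2)) := by
    have := mul_le_mul_of_nonneg_left hlog2.le hL0.le
    rw [hδL]
    exact Real.exp_le_exp.2 (by linarith)
  have hN64 : 64 ≤ (n : ℝ) / L := by rw [le_div_iff₀ hL0]; linarith
  have hnN : (n : ℝ) = L * (n / L) := (mul_div_cancel₀ _ hL0.ne').symm
  generalize (n : ℝ) / L = N at *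
  have hN0 : 0 < N := by linarith
  have hlogN : Real.log N = Real.logb 2 N * Real.log 2 := (div_mul_cancel₀ _ hlog0).symm
  have hb6 : 6 ≤ Real.logb 2 N := by
    rw [Real.le_logb_iff_rpow_le (by norm_num) hN0]
    norm_num; exact hN64
  generalize Real.logb 2 N = b at *
  obtain ⟨θ, p, R, k, hθ0, hθ1, hp0, hp1, hRge, hk1, hk2, hmiss, hρ⟩ :=
    exists_parameters hL hN64 hnN hb6 hlogN hδ2
  have hLb : 64 * 6 ≤ L * b := mul_le_mul hL hb6 (by norm_num) hL0.le
  have hR0 : 0 < R := by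
    have : (0 : ℝ) < R := by linarith
    exact_mod_cast this
  have hmain := half_le_of_solves hδ.le hP hs hθ0 hθ1 hp0 hp1 hR0 hk1 hmiss
  rw [hρ, hlogN] at hmain
  have hlogs := Real.logb_le_logb_of_le (b := 2) (by norm_num) (by norm_num) hmain
  have hlogρ : Real.logb 2 (Real.exp (-(b * Real.log 2 / 2))) = -(b / 2) := by
    rw [Real.logb, Real.log_exp]; field_simp
  rw [Real.logb_mul (by positivity) (by positivity), Real.logb_mul (by positivity)
    (by positivity), Real.logb_pow, Real.logb_pow, Real.logb_pow, hlogρ, one_div, Real.logb_inv,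
    Real.logb_self_eq_one (by norm_num)] at hlogs
  push_cast at hlogs
  have hk3 : 3 * (R : ℝ) ≤ 4 * k := by exact_mod_cast hk2
  have h1 : 3 * (R : ℝ) * b ≤ 4 * k * b := mul_le_mul_of_nonneg_right hk3 (by linarith)
  have h2 : (L * b / 32 - 1) * (3 / 8 * b - 1) ≤ R * (3 / 8 * b - 1) :=
    mul_le_mul_of_nonneg_right hRge (by linarith)
  have h3 : (s : ℝ) ≥ R * (3 / 8 * b - 1) - 2 := by linarith
  have h4 : 11 / 384 * (L * b) * (5 / 24 * b) ≤ (L * b / 32 - 1) * (3 / 8 * b - 1) :=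
    mul_le_mul (by linarith) (by linarith) (by linarith) (by linarith)
  have h5 : 64 * 6 * 6 ≤ L * b * b := mul_le_mul hLb hb6 (by norm_num) (by linarith)
  have e1 : L * b ^ 2 = L * b * b := by ring
  have e2 : 11 / 384 * (L * b) * (5 / 24 * b) = 55 / 9216 * (L * b * b) := by ring
  rw [e1]
  linarith

theorem mainTheorem3 :
    ∃ c : ℝ, 0 < c ∧ ∀ (n : ℕ) (δ : ℝ), 0 < δ →
      64 ≤ Real.logb 2 (1 / δ) → Real.logb 2 (1 / δ) ≤ (n : ℝ) / 64 →
        ENNReal.ofReal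
            (c * (Real.logb 2 (1 / δ) * (Real.logb 2 ((n : ℝ) / Real.logb 2 (1 / δ))) ^ 2)) ≤
          (oneWayPubCC δ (URsub n) : ℝ≥0∞) := by
  refine ⟨1 / 512, by norm_num, fun n δ hδ hL hn => ?_⟩
  set x := 1 / 512 * (Real.logb 2 (1 / δ) *
    (Real.logb 2 ((n : ℝ) / Real.logb 2 (1 / δ))) ^ 2) with hx
  have hCC : ((⌈x⌉₊ : ℕ) : ℕ∞) ≤ oneWayPubCC δ (URsub n) := by
    refine le_iInf₂ fun P hP => ?_
    cases hcost : P.cost with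
    | top => exact le_top
    | coe s =>
      have hs : ∀ r x, (P.alice r x).length ≤ s := by
        intro r x
        have h : ((P.alice r x).length : ℕ∞) ≤ P.cost :=
          le_iSup₂ (f := fun r x => ((P.alice r x).length : ℕ∞)) r x
        rw [hcost] at h
        exact_mod_cast h
      exact_mod_cast Nat.ceil_le.2 (length_ge_of_solves hδ hL hn hP hs)
  calc ENNReal.ofReal x ≤ ENNReal.ofReal (⌈x⌉₊ : ℕ) := ENNReal.ofReal_le_ofReal (Nat.le_ceil x)
    _ = (((⌈x⌉₊ : ℕ) : ℕ∞) : ℝ≥0∞) := by simp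
    _ ≤ _ := ENat.toENNReal_le.2 hCC
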